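/- Let $H\ge 0$ be a real number. For real $C>2\bigl(H+\sqrt{1+H^2}\bigr)$ put $$t_1=\sqrt{\frac{C-2H-\sqrt{C^2-4HC-4}}{2(1+H^2)}},\qquad t_2=\sqrt{\frac{C-2H+\sqrt{C^2-4HC-4}}{2(1+H^2)}},$$ the two positive roots of $\xi(s)=Cs^2-1-(1+H^2)s^4-2Hs^2$, and define the period function $$K(H,C)=\int_{t_1^2/C}^{t_2^2/C}\frac{Hu+C^{-1}}{\sqrt{u}\,(1-u)\,\sqrt{-u^2(1+H^2)+(1-2HC^{-1})u-C^{-2}}}\,du .$$ Then for every $C>2\bigl(H+\sqrt{1+H^2}\bigr)$ this integral converges absolutely, and the function $C\mapsto K(H,C)$ is strictly decreasing on the interval $\bigl(2(H+\sqrt{1+H^2}),\infty\bigr)$. -/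

import Mathlib

open MeasureTheory

noncomputable section

/-- The smaller positive root `t₁` of `ξ(s) = C s² - 1 - (1 + H²) s⁴ - 2 H s²`. -/
def t₁ (H C : ℝ) : ℝ :=
  √((C - 2 * H - √(C ^ 2 - 4 * H * C - 4)) / (2 * (1 + H ^ 2)))

/-- The larger positive root `t₂` of `ξ(s) = C s² - 1 - (1 + H²) s⁴ - 2 H s²`. -/
def t₂ (H C : ℝ) : ℝ :=
  √((C - 2 * H + √(C ^ 2 - 4 * H * C - 4)) / (2 * (1 + H ^ 2)))

/-- The integrand of the period function. -/
def periodIntegrand (H C u : ℝ) : ℝ :=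
  (H * u + C⁻¹) /
    (√u * (1 - u) * √(-u ^ 2 * (1 + H ^ 2) + (1 - 2 * H * C⁻¹) * u - (C ^ 2)⁻¹))

/-- The period function `K(H, C)`. -/
def periodK (H C : ℝ) : ℝ :=
  ∫ u in ((t₁ H C) ^ 2 / C)..((t₂ H C) ^ 2 / C), periodIntegrand H C u

end

/-! Put `c = C⁻¹`. The last radicand in the integrand is `u(1-u) - (Hu+c)²`, so with `u = x²/(1+x²)`
it becomes `x²(1 - ((H+c)x + c/x)²)/(1+x²)²`. Setting `(H+c)x - c/x = p sin φ`, where `p² = 1 -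
4c(H+c)`, turns the bracket into `p² cos² φ`. All singular factors cancel (`deriv_smul_integrand`),
so `K` is the integral of the continuous function `2√u` over `[-π/2, π/2]`; convergence is then
clear.

The values of `√u` at `φ` and `-φ` are added. The square of the sum is `(1 + v/r)(1 - H/r)` with `v
= H + 2c` and `r² = v² cos² φ + (1+H²) sin² φ` (`sinParam_add_neg_sq`). Both factors grow with `c`,
the first strictly when `sin φ ≠ 0`, so `K` increases in `c` and decreases in `C`. -/

/-- The half-width of the interval of integration, up to the factor `2 (1 + H²)`; here and below
`c` stands for `C⁻¹`. -/
noncomputable def amplitude (H c : ℝ) : ℝ := √(1 - 4 * c * (H + c))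

/-- The value of `(H + c) x + c / x` at `x = tanParam H c φ`. -/
noncomputable def radical (H c φ : ℝ) : ℝ :=
  √(4 * c * (H + c) + (amplitude H c * Real.sin φ) ^ 2)

/-- The solution `x > 0` of `(H + c) x - c / x = amplitude H c * sin φ`. -/
noncomputable def tanParam (H c φ : ℝ) : ℝ :=
  (radical H c φ + amplitude H c * Real.sin φ) / (2 * (H + c))

/-- The parametrization of the interval of integration that resolves the end point
singularities. -/
noncomputable def sqParam (H c φ : ℝ) : ℝ :=
  (tanParam H c φ) ^ 2 / (1 + (tanParam H c φ) ^ 2)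

/-- The square root of `sqParam H c φ`. -/
noncomputable def sinParam (H c φ : ℝ) : ℝ :=
  tanParam H c φ / √(1 + (tanParam H c φ) ^ 2)

/-! ### The substitution and its derivative -/

section Parametrization

variable {H c : ℝ}

theorem amplitude_sq (h : 4 * c * (H + c) < 1) :
    amplitude H c ^ 2 = 1 - 4 * c * (H + c) :=
  Real.sq_sqrt (by linarith)

theorem amplitude_pos (h : 4 * c * (H + c) < 1) : 0 < amplitude H c :=
  Real.sqrt_pos.2 (by linarith)

theorem radicand_pos (hH : 0 ≤ H) (hc : 0 < c) (φ : ℝ) :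
    0 < 4 * c * (H + c) + (amplitude H c * Real.sin φ) ^ 2 := by positivity

theorem radical_sq (hH : 0 ≤ H) (hc : 0 < c) (φ : ℝ) :
    radical H c φ ^ 2 = 4 * c * (H + c) + (amplitude H c * Real.sin φ) ^ 2 :=
  Real.sq_sqrt (radicand_pos hH hc φ).le

theorem radical_pos (hH : 0 ≤ H) (hc : 0 < c) (φ : ℝ) : 0 < radical H c φ :=
  Real.sqrt_pos.2 (radicand_pos hH hc φ)

theorem tanParam_pos (hH : 0 ≤ H) (hc : 0 < c) (φ : ℝ) : 0 < tanParam H c φ := by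
  have hr := radical_pos hH hc φ
  have hsq := radical_sq hH hc φ
  have : 0 < c * (H + c) := by positivity
  refine div_pos ?_ (by positivity)
  have := abs_lt_of_sq_lt_sq (by nlinarith : (amplitude H c * Real.sin φ) ^ 2 <
    radical H c φ ^ 2) hr.le
  linarith [(abs_lt.1 this).1]

theorem tanParam_add (hH : 0 ≤ H) (hc : 0 < c) (φ : ℝ) :
    (H + c) * tanParam H c φ ^ 2 + c = tanParam H c φ * radical H c φ := by
  have hk : 0 < H + c := by positivity
  have hsq := radical_sq hH hc φ
  unfold tanParam
  field_simp
  linear_combination (-1) * hsq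

theorem tanParam_eq (hH : 0 ≤ H) (hc : 0 < c) (φ : ℝ) :
    2 * (H + c) * tanParam H c φ = radical H c φ + amplitude H c * Real.sin φ := by
  have hk : 0 < H + c := by positivity
  unfold tanParam
  field_simp

theorem tanParam_neg_eq (hH : 0 ≤ H) (hc : 0 < c) (φ : ℝ) :
    2 * (H + c) * tanParam H c (-φ) = radical H c φ - amplitude H c * Real.sin φ := by
  rw [tanParam_eq hH hc]
  simp [radical, sub_eq_add_neg]

theorem continuous_tanParam (H c : ℝ) : Continuous (tanParam H c) := by
  unfold tanParam radical
  fun_prop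

theorem continuous_sinParam (H c : ℝ) : Continuous (sinParam H c) := by
  unfold sinParam
  have := continuous_tanParam H c
  refine this.div (by fun_prop) fun φ => ?_
  positivity

theorem continuous_sqParam (H c : ℝ) : Continuous (sqParam H c) := by
  unfold sqParam
  have := continuous_tanParam H c
  refine (this.pow 2).div (by fun_prop) fun φ => ?_
  positivity

theorem sinParam_pos (hH : 0 ≤ H) (hc : 0 < c) (φ : ℝ) : 0 < sinParam H c φ := by
  have := tanParam_pos hH hc φ
  unfold sinParam
  positivity

theorem hasDerivAt_tanParam (hH : 0 ≤ H) (hc : 0 < c) (φ : ℝ) :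
    HasDerivAt (tanParam H c)
      (amplitude H c * Real.cos φ * tanParam H c φ / radical H c φ) φ := by
  have hk : 0 < H + c := by positivity
  have hr := radical_pos hH hc φ
  have h1 : HasDerivAt (fun φ => amplitude H c * Real.sin φ) (amplitude H c * Real.cos φ) φ :=
    (Real.hasDerivAt_sin φ).const_mul _
  have h2 := ((h1.pow 2).const_add (4 * c * (H + c))).sqrt (radicand_pos hH hc φ).ne'
  have h3 := (h2.add h1).div_const (2 * (H + c))
  refine h3.congr_deriv ?_
  have ex := tanParam_eq hH hc φ
  rw [show amplitude H c * Real.cos φ * tanParam H c φ / radical H c φ =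
    amplitude H c * Real.cos φ * (2 * (H + c) * tanParam H c φ) /
      (2 * (H + c) * radical H c φ) by field_simp, ex]
  change (_ / (2 * radical H c φ) + _) / _ = _
  field_simp
  simp
  ring

theorem hasDerivAt_sqParam (hH : 0 ≤ H) (hc : 0 < c) (φ : ℝ) :
    HasDerivAt (sqParam H c)
      (2 * tanParam H c φ / (1 + tanParam H c φ ^ 2) ^ 2 *
        (amplitude H c * Real.cos φ * tanParam H c φ / radical H c φ)) φ := by
  have hx := hasDerivAt_tanParam hH hc φ
  have hpos : 0 < 1 + tanParam H c φ ^ 2 := by positivity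
  refine ((hx.pow 2).div ((hx.pow 2).const_add 1) hpos.ne').congr_deriv ?_
  have hr := radical_pos hH hc φ
  simp
  field_simp
  ring

/-- The factor `cos φ` of the derivative cancels the one in the radical, hence the restriction to
`cos φ > 0`. -/
theorem deriv_smul_integrand (hH : 0 ≤ H) (hc : 0 < c) (h : 4 * c * (H + c) < 1) {φ : ℝ}
    (hφ : 0 < Real.cos φ) :
    (2 * tanParam H c φ / (1 + tanParam H c φ ^ 2) ^ 2 *
        (amplitude H c * Real.cos φ * tanParam H c φ / radical H c φ)) •
      periodIntegrand H c⁻¹ (sqParam H c φ) = 2 * sinParam H c φ := by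
  have hp := amplitude_pos h
  have hp2 := amplitude_sq h
  have hr := radical_pos hH hc φ
  have hx := tanParam_pos hH hc φ
  have hadd := tanParam_add hH hc φ
  have hsq := radical_sq hH hc φ
  have hcs := Real.sin_sq_add_cos_sq φ
  unfold periodIntegrand sqParam sinParam
  generalize tanParam H c φ = x at *
  generalize radical H c φ = r at *
  generalize amplitude H c = p at *
  generalize Real.sin φ = s at *
  generalize Real.cos φ = d at *
  have hn : 0 < 1 + x ^ 2 := by positivity
  have h1 : √(x ^ 2 / (1 + x ^ 2)) = x / √(1 + x ^ 2) := by
    rw [Real.sqrt_div (by positivity), Real.sqrt_sq hx.le]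
  have h2 : H * (x ^ 2 / (1 + x ^ 2)) + c = x * r / (1 + x ^ 2) := by
    rw [← hadd]; field_simp; ring
  have h3 : √(-(x ^ 2 / (1 + x ^ 2)) ^ 2 * (1 + H ^ 2) +
      (1 - 2 * H * c) * (x ^ 2 / (1 + x ^ 2)) - c ^ 2) = x * p * d / (1 + x ^ 2) := by
    rw [show -(x ^ 2 / (1 + x ^ 2)) ^ 2 * (1 + H ^ 2) +
      (1 - 2 * H * c) * (x ^ 2 / (1 + x ^ 2)) - c ^ 2 = (x * p * d / (1 + x ^ 2)) ^ 2 from ?_,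
      Real.sqrt_sq (by positivity)]
    have e1 : -(x ^ 2 / (1 + x ^ 2)) ^ 2 * (1 + H ^ 2) +
      (1 - 2 * H * c) * (x ^ 2 / (1 + x ^ 2)) - c ^ 2 =
      (x ^ 2 / (1 + x ^ 2) - (x ^ 2 / (1 + x ^ 2)) ^ 2) -
        (H * (x ^ 2 / (1 + x ^ 2)) + c) ^ 2 := by ring
    rw [e1, h2]
    have e2 : p ^ 2 * d ^ 2 = 1 - r ^ 2 := by
      linear_combination p ^ 2 * hcs + hp2 + hsq
    field_simp
    linear_combination (-1) * e2
  have h4 : 1 - x ^ 2 / (1 + x ^ 2) = 1 / (1 + x ^ 2) := by field_simp; ring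
  have h5 : √(1 + x ^ 2) ^ 2 = 1 + x ^ 2 := Real.sq_sqrt hn.le
  have h6 : 0 < √(1 + x ^ 2) := Real.sqrt_pos.2 hn
  simp only [inv_inv, ← inv_pow, smul_eq_mul]
  rw [h1, h2, h3, h4]
  generalize √(1 + x ^ 2) = y at *
  rw [← h5]
  field_simp

/-! ### End points of the interval of integration -/

/-- The sign of `p` is left free so that `p = ± amplitude H c` covers both end points, where the
radical equals 1. -/
theorem sq_div_one_add_sq_eq (hH : 0 ≤ H) (hc : 0 < c) {p x : ℝ}
    (hp2 : p ^ 2 = 1 - 4 * c * (H + c)) (hx : 2 * (H + c) * x = 1 + p) :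
    x ^ 2 / (1 + x ^ 2) = (1 - 2 * H * c + p) / (2 * (1 + H ^ 2)) := by
  have hk : 0 < H + c := by positivity
  have hn : 0 < 1 + x ^ 2 := by positivity
  have hn' : 0 < 1 + H ^ 2 := by positivity
  rw [div_eq_div_iff hn.ne' (by positivity)]
  have hk2 : (2 * (H + c)) ^ 2 ≠ 0 := by positivity
  apply mul_left_cancel₀ hk2
  have e : (2 * (H + c)) ^ 2 * x ^ 2 = (1 + p) ^ 2 := by rw [← hx]; ring
  have e3 : (2 * (H + c)) ^ 2 = 4 * H ^ 2 + 4 * H * c + 1 - p ^ 2 := by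
    rw [hp2]; ring
  calc (2 * (H + c)) ^ 2 * (x ^ 2 * (2 * (1 + H ^ 2)))
      = ((2 * (H + c)) ^ 2 * x ^ 2) * (2 * (1 + H ^ 2)) := by ring
    _ = (1 - 2 * H * c + p) * ((2 * (H + c)) ^ 2 + (2 * (H + c)) ^ 2 * x ^ 2) := by
      rw [e, e3]; linear_combination (2 * H ^ 2 ) * hp2
    _ = _ := by ring

theorem radical_of_sin_sq_eq_one (h : 4 * c * (H + c) < 1) {φ : ℝ} (hφ : Real.sin φ ^ 2 = 1) :
    radical H c φ = 1 := by
  unfold radical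
  rw [mul_pow, hφ, amplitude_sq h]
  simp

theorem sqParam_pi_div_two (hH : 0 ≤ H) (hc : 0 < c) (h : 4 * c * (H + c) < 1) :
    sqParam H c (Real.pi / 2) = (1 - 2 * H * c + amplitude H c) / (2 * (1 + H ^ 2)) := by
  refine sq_div_one_add_sq_eq hH hc (amplitude_sq h) ?_
  rw [tanParam_eq hH hc, radical_of_sin_sq_eq_one h (by simp)]
  simp

theorem sqParam_neg_pi_div_two (hH : 0 ≤ H) (hc : 0 < c) (h : 4 * c * (H + c) < 1) :
    sqParam H c (-(Real.pi / 2)) = (1 - 2 * H * c - amplitude H c) / (2 * (1 + H ^ 2)) := by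
  rw [sub_eq_add_neg]
  refine sq_div_one_add_sq_eq hH hc (by rw [neg_sq, amplitude_sq h]) ?_
  rw [tanParam_neg_eq hH hc, radical_of_sin_sq_eq_one h (by simp)]
  simp [sub_eq_add_neg]

theorem sqrt_discriminant (hc : 0 < c) :
    √(c⁻¹ ^ 2 - 4 * H * c⁻¹ - 4) = amplitude H c / c := by
  unfold amplitude
  rw [← Real.sqrt_sq hc.le, ← Real.sqrt_div' _ (by positivity), Real.sqrt_sq hc.le]
  congr 1
  field_simp
  ring

theorem amplitude_le (h : 4 * c * (H + c) < 1) :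
    amplitude H c ≤ 1 - 2 * H * c := by
  refine Real.sqrt_le_iff.2 ⟨?_, ?_⟩
  · nlinarith [sq_nonneg c]
  · nlinarith [sq_nonneg c, sq_nonneg (H * c)]

theorem t₁_sq_div (hH : 0 ≤ H) (hc : 0 < c) (h : 4 * c * (H + c) < 1) :
    t₁ H c⁻¹ ^ 2 / c⁻¹ = sqParam H c (-(Real.pi / 2)) := by
  have hle := amplitude_le h
  have e : (c⁻¹ - 2 * H - amplitude H c / c) / (2 * (1 + H ^ 2)) =
      (1 - 2 * H * c - amplitude H c) / c / (2 * (1 + H ^ 2)) := by field_simp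
  rw [sqParam_neg_pi_div_two hH hc h, t₁, sqrt_discriminant hc, e, Real.sq_sqrt]
  · field_simp
  · have : 0 ≤ 1 - 2 * H * c - amplitude H c := by linarith
    positivity

theorem t₂_sq_div (hH : 0 ≤ H) (hc : 0 < c) (h : 4 * c * (H + c) < 1) :
    t₂ H c⁻¹ ^ 2 / c⁻¹ = sqParam H c (Real.pi / 2) := by
  have hle := amplitude_le h
  have hp := amplitude_pos h
  have e : (c⁻¹ - 2 * H + amplitude H c / c) / (2 * (1 + H ^ 2)) =
      (1 - 2 * H * c + amplitude H c) / c / (2 * (1 + H ^ 2)) := by field_simp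
  rw [sqParam_pi_div_two hH hc h, t₂, sqrt_discriminant hc, e, Real.sq_sqrt]
  · field_simp
  · have : 0 ≤ 1 - 2 * H * c + amplitude H c := by linarith
    positivity

/-! ### Convergence and change of variables -/

theorem sqParam_deriv_nonneg (hH : 0 ≤ H) (hc : 0 < c) (h : 4 * c * (H + c) < 1) {φ : ℝ}
    (hφ : φ ∈ Set.Ioo (-(Real.pi / 2)) (Real.pi / 2)) :
    0 ≤ 2 * tanParam H c φ / (1 + tanParam H c φ ^ 2) ^ 2 *
        (amplitude H c * Real.cos φ * tanParam H c φ / radical H c φ) := by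
  have := Real.cos_pos_of_mem_Ioo hφ
  have := tanParam_pos hH hc φ
  have := radical_pos hH hc φ
  have := amplitude_pos h
  positivity

theorem sqParam_endpoints_le (hH : 0 ≤ H) (hc : 0 < c) (h : 4 * c * (H + c) < 1) :
    sqParam H c (-(Real.pi / 2)) ≤ sqParam H c (Real.pi / 2) := by
  have := amplitude_pos h
  rw [sqParam_pi_div_two hH hc h, sqParam_neg_pi_div_two hH hc h]
  gcongr
  linarith

theorem intervalIntegrable_periodIntegrand (hH : 0 ≤ H) (hc : 0 < c)
    (h : 4 * c * (H + c) < 1) :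
    IntervalIntegrable (periodIntegrand H c⁻¹) volume
      (t₁ H c⁻¹ ^ 2 / c⁻¹) (t₂ H c⁻¹ ^ 2 / c⁻¹) := by
  rw [t₁_sq_div hH hc h, t₂_sq_div hH hc h,
    intervalIntegrable_iff_integrableOn_Icc_of_le (sqParam_endpoints_le hH hc h),
    ← integrableOn_Icc_deriv_smul_iff_of_deriv_nonneg (continuous_sqParam H c).continuousOn
      (fun φ _ => hasDerivAt_sqParam hH hc φ) (fun φ hφ => sqParam_deriv_nonneg hH hc h hφ)
      (by linarith [Real.pi_pos]), integrableOn_Icc_iff_integrableOn_Ioo]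
  -- On the open interval the pulled-back integrand is a continuous function; the end points, where
  -- `cos φ = 0`, are null.
  refine IntegrableOn.congr_fun (f := fun φ => 2 * sinParam H c φ) ?_
    (fun φ hφ => (deriv_smul_integrand hH hc h (Real.cos_pos_of_mem_Ioo hφ)).symm)
    measurableSet_Ioo
  exact (((continuous_sinParam H c).const_mul 2).continuousOn.integrableOn_Icc).mono_set
    Set.Ioo_subset_Icc_self

theorem periodK_eq_integral_sinParam (hH : 0 ≤ H) (hc : 0 < c) (h : 4 * c * (H + c) < 1) :
    periodK H c⁻¹ = ∫ φ in (-(Real.pi / 2))..(Real.pi / 2), 2 * sinParam H c φ := by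
  rw [periodK, t₁_sq_div hH hc h, t₂_sq_div hH hc h,
    intervalIntegral.integral_of_le (sqParam_endpoints_le hH hc h), ← integral_Icc_eq_integral_Ioc,
    ← integral_Icc_deriv_smul_of_deriv_nonneg (continuous_sqParam H c).continuousOn
      (fun φ _ => hasDerivAt_sqParam hH hc φ) (fun φ hφ => sqParam_deriv_nonneg hH hc h hφ)
      (by linarith [Real.pi_pos]), integral_Icc_eq_integral_Ioo,
    intervalIntegral.integral_of_le (by linarith [Real.pi_pos]), integral_Ioc_eq_integral_Ioo]
  exact setIntegral_congr_fun measurableSet_Ioo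
    fun φ hφ => deriv_smul_integrand hH hc h (Real.cos_pos_of_mem_Ioo hφ)

/-! ### Symmetrization in `φ` -/

theorem periodK_eq_integral_symmetrized (hH : 0 ≤ H) (hc : 0 < c) (h : 4 * c * (H + c) < 1) :
    periodK H c⁻¹ =
      ∫ φ in (0)..(Real.pi / 2), 2 * (sinParam H c φ + sinParam H c (-φ)) := by
  have hi : ∀ a b, IntervalIntegrable (sinParam H c) volume a b :=
    fun a b => (continuous_sinParam H c).intervalIntegrable a b
  have hi' : IntervalIntegrable (fun φ => sinParam H c (-φ)) volume 0 (Real.pi / 2) :=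
    ((continuous_sinParam H c).comp continuous_neg).intervalIntegrable _ _
  rw [periodK_eq_integral_sinParam hH hc h, intervalIntegral.integral_const_mul,
    intervalIntegral.integral_const_mul, intervalIntegral.integral_add (hi _ _) hi',
    intervalIntegral.integral_comp_neg, neg_zero,
    ← intervalIntegral.integral_add_adjacent_intervals (hi _ 0) (hi 0 _), add_comm]

/-- With `v = H + 2 c`, the squared symmetrized integrand is `(1 + v / r) (1 - H / r)`. -/
theorem sinParam_add_neg_sq (hH : 0 ≤ H) (hc : 0 < c) (h : 4 * c * (H + c) < 1) {φ r : ℝ} (hr : 0 < r)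
    (hr2 : r ^ 2 = (H + 2 * c) ^ 2 * Real.cos φ ^ 2 + (1 + H ^ 2) * Real.sin φ ^ 2) :
    (sinParam H c φ + sinParam H c (-φ)) ^ 2 = (1 + (H + 2 * c) / r) * (1 - H / r) := by
  have hk : 0 < H + c := by positivity
  have hx := tanParam_pos hH hc φ
  have hy := tanParam_pos hH hc (-φ)
  have ex := tanParam_eq hH hc φ
  have ey := tanParam_neg_eq hH hc φ
  have hq := radical_sq hH hc φ
  have hp2 := amplitude_sq h
  have hcs := Real.sin_sq_add_cos_sq φ
  unfold sinParam
  generalize tanParam H c φ = x at *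
  generalize tanParam H c (-φ) = y at *
  generalize radical H c φ = q at *
  generalize amplitude H c = p at *
  generalize Real.sin φ = s at *
  generalize Real.cos φ = d at *
  have hd : d ^ 2 = 1 - s ^ 2 := by linarith
  -- `x` and `-y` are the two roots of `(H+c)X² - p s X - c = 0`.
  have hxy : (H + c) * (x * y) = c := by
    apply mul_left_cancel₀ (show 4 * (H + c) ≠ 0 by positivity)
    linear_combination (2 * (H + c) * y) * ex + (q + p * s) * ey + hq
  have hxy' : x * y = c / (H + c) := by rw [eq_div_iff hk.ne']; linarith
  have hD : (H + c) ^ 2 * ((1 + x ^ 2) * (1 + y ^ 2)) = r ^ 2 := by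
    have e : (H + c) ^ 2 * (x + y) ^ 2 = q ^ 2 := by
      have : (H + c) * (x + y) = q := by linarith
      rw [← this]; ring
    -- This is `(1+x²)(1+y²) = (x+y)² + (1-xy)²`; since `(H+c)(1-xy) = H`, it gives `r² = q² + H²`.
    have e2 : (H + c) ^ 2 * ((1 + x ^ 2) * (1 + y ^ 2)) =
        (H + c) ^ 2 * (x + y) ^ 2 + (H + c - (H + c) * (x * y)) ^ 2 := by ring
    rw [e2, e, hxy, hq, hr2, hd, mul_pow, hp2]; ring
  have hD' : √(1 + x ^ 2) * √(1 + y ^ 2) = r / (H + c) := by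
    rw [← Real.sqrt_mul (by positivity), Real.sqrt_eq_iff_mul_self_eq (by positivity)
      (by positivity)]
    field_simp
    linarith
  have hX := Real.sq_sqrt (show 0 ≤ 1 + x ^ 2 by positivity)
  have hY := Real.sq_sqrt (show 0 ≤ 1 + y ^ 2 by positivity)
  have hX0 : 0 < √(1 + x ^ 2) := by positivity
  have hY0 : 0 < √(1 + y ^ 2) := by positivity
  have hcross : x / √(1 + x ^ 2) * (y / √(1 + y ^ 2)) = c / r := by
    rw [div_mul_div_comm, hD', hxy']
    field_simp
  have hsum : x ^ 2 / (1 + x ^ 2) + y ^ 2 / (1 + y ^ 2) = 1 - H * (H + 2 * c) / r ^ 2 := by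
    have e : x ^ 2 / (1 + x ^ 2) + y ^ 2 / (1 + y ^ 2) =
        1 - (1 - (x * y) ^ 2) / ((1 + x ^ 2) * (1 + y ^ 2)) := by field_simp; ring
    rw [e, ← hD, hxy']
    field_simp
    ring
  calc (x / √(1 + x ^ 2) + y / √(1 + y ^ 2)) ^ 2
      = (x ^ 2 / √(1 + x ^ 2) ^ 2 + y ^ 2 / √(1 + y ^ 2) ^ 2) +
        2 * (x / √(1 + x ^ 2) * (y / √(1 + y ^ 2))) := by ring
    _ = (1 - H * (H + 2 * c) / r ^ 2) + 2 * (c / r) := by rw [hX, hY, hsum, hcross]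
    _ = _ := by field_simp; ring

end Parametrization

/-! ### Monotonicity in `c` -/

theorem sinParam_add_neg_lt {H c c' φ : ℝ} (hH : 0 ≤ H) (hc : 0 < c) (hcc : c < c')
    (h : 4 * c' * (H + c') < 1) (hs : Real.sin φ ≠ 0) :
    sinParam H c φ + sinParam H c (-φ) < sinParam H c' φ + sinParam H c' (-φ) := by
  have hc' : 0 < c' := hc.trans hcc
  have h0 : 4 * c * (H + c) < 1 := lt_of_le_of_lt (by gcongr) h
  have hs2 : 0 < Real.sin φ ^ 2 := by positivity
  have hcs := Real.sin_sq_add_cos_sq φ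
  have hpos : ∀ v : ℝ, 0 < v ^ 2 * Real.cos φ ^ 2 + (1 + H ^ 2) * Real.sin φ ^ 2 :=
    fun v => by positivity
  refine lt_of_pow_lt_pow_left₀ 2
    (add_pos (sinParam_pos hH hc' _) (sinParam_pos hH hc' _)).le ?_
  have hr := Real.sqrt_pos.2 (hpos (H + 2 * c))
  have hr' := Real.sqrt_pos.2 (hpos (H + 2 * c'))
  have hr2 := Real.sq_sqrt (hpos (H + 2 * c)).le
  have hr2' := Real.sq_sqrt (hpos (H + 2 * c')).le
  rw [sinParam_add_neg_sq hH hc h0 hr hr2, sinParam_add_neg_sq hH hc' h hr' hr2']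
  have hle : √((H + 2 * c) ^ 2 * Real.cos φ ^ 2 + (1 + H ^ 2) * Real.sin φ ^ 2) ≤
      √((H + 2 * c') ^ 2 * Real.cos φ ^ 2 + (1 + H ^ 2) * Real.sin φ ^ 2) := by gcongr
  -- From `v ≥ H` follows `r² ≥ H² + sin² φ`, so the second factor is positive.
  have hHr : H < √((H + 2 * c) ^ 2 * Real.cos φ ^ 2 + (1 + H ^ 2) * Real.sin φ ^ 2) := by
    refine Real.lt_sqrt_of_sq_lt ?_
    have : H ^ 2 ≤ (H + 2 * c) ^ 2 := by gcongr; linarith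
    nlinarith [mul_le_mul_of_nonneg_right this (sq_nonneg (Real.cos φ))]
  generalize √((H + 2 * c) ^ 2 * Real.cos φ ^ 2 + (1 + H ^ 2) * Real.sin φ ^ 2) = r at *
  generalize √((H + 2 * c') ^ 2 * Real.cos φ ^ 2 + (1 + H ^ 2) * Real.sin φ ^ 2) = r' at *
  -- After squaring and cross-multiplying, the `cos²` terms agree and only the `sin²` terms remain.
  have hfirst : (H + 2 * c) / r < (H + 2 * c') / r' := by
    rw [div_lt_div_iff₀ hr hr']
    refine lt_of_pow_lt_pow_left₀ 2 (by positivity) ?_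
    rw [mul_pow, mul_pow, hr2, hr2']
    have : (H + 2 * c) ^ 2 < (H + 2 * c') ^ 2 := by gcongr
    have : (H + 2 * c) ^ 2 * ((1 + H ^ 2) * Real.sin φ ^ 2) <
      (H + 2 * c') ^ 2 * ((1 + H ^ 2) * Real.sin φ ^ 2) := by gcongr
    linarith
  have hsecond : 1 - H / r ≤ 1 - H / r' := by gcongr
  have hpos' : 0 < 1 - H / r := by rw [sub_pos, div_lt_one hr]; exact hHr
  have : 0 ≤ 1 + (H + 2 * c) / r := by positivity
  exact mul_lt_mul (by linarith) hsecond hpos' (by linarith)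

theorem periodK_inv_lt {H c c' : ℝ} (hH : 0 ≤ H) (hc : 0 < c) (hcc : c < c')
    (h : 4 * c' * (H + c') < 1) : periodK H c⁻¹ < periodK H c'⁻¹ := by
  have hc' : 0 < c' := hc.trans hcc
  have h0 : 4 * c * (H + c) < 1 := lt_of_le_of_lt (by gcongr) h
  have hpi := Real.pi_pos
  have hcont : ∀ c, Continuous fun φ => 2 * (sinParam H c φ + sinParam H c (-φ)) := fun c =>
    ((continuous_sinParam H c).add ((continuous_sinParam H c).comp continuous_neg)).const_mul 2
  rw [periodK_eq_integral_symmetrized hH hc h0, periodK_eq_integral_symmetrized hH hc' h]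
  -- The point `φ = 0` is left out: there `v/r = 1` for every `c`.
  have hlt : ∀ φ ∈ Set.Ioc 0 (Real.pi / 2), 2 * (sinParam H c φ + sinParam H c (-φ)) <
      2 * (sinParam H c' φ + sinParam H c' (-φ)) := fun φ hφ => by
    have := sinParam_add_neg_lt hH hc hcc h
      (Real.sin_pos_of_pos_of_lt_pi hφ.1 (by linarith [hφ.2])).ne'
    linarith
  exact intervalIntegral.integral_lt_integral_of_continuousOn_of_le_of_exists_lt (by positivity)
    (hcont c).continuousOn (hcont c').continuousOn (fun φ hφ => (hlt φ hφ).le)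
    ⟨Real.pi / 2, ⟨by positivity, le_rfl⟩, hlt _ ⟨by positivity, le_rfl⟩⟩

theorem inv_mem_of_lt {H C : ℝ} (hH : 0 ≤ H) (hC : 2 * (H + √(1 + H ^ 2)) < C) :
    0 < C⁻¹ ∧ 4 * C⁻¹ * (H + C⁻¹) < 1 := by
  have hs : 0 < √(1 + H ^ 2) := by positivity
  have hs2 := Real.sq_sqrt (show 0 ≤ 1 + H ^ 2 by positivity)
  have hC0 : 0 < C := by linarith
  refine ⟨inv_pos.2 hC0, ?_⟩
  -- `2(H + √(1+H²))` is the larger root of `C² - 4HC - 4`.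
  have : 4 * H * C + 4 < C ^ 2 := by nlinarith
  field_simp
  linarith

theorem mainTheorem4 (H : ℝ) (hH : 0 ≤ H) :
    (∀ C : ℝ, 2 * (H + √(1 + H ^ 2)) < C →
      IntervalIntegrable (periodIntegrand H C) volume
        ((t₁ H C) ^ 2 / C) ((t₂ H C) ^ 2 / C)) ∧
    StrictAntiOn (fun C : ℝ => periodK H C) (Set.Ioi (2 * (H + √(1 + H ^ 2)))) := by
  refine ⟨fun C hC => ?_, fun C hC C' hC' hlt => ?_⟩
  · obtain ⟨hc, h⟩ := inv_mem_of_lt hH hC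
    simpa only [inv_inv] using intervalIntegrable_periodIntegrand hH hc h
  · obtain ⟨hc, h⟩ := inv_mem_of_lt hH hC
    obtain ⟨hc', _⟩ := inv_mem_of_lt hH hC'
    have := periodK_inv_lt hH hc' (inv_strictAnti₀ (inv_pos.1 hc) hlt) h
    simpa only [inv_inv] using this
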